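/- Let $1\le p<\infty$, $p\neq 2$, let $D$ be the open unit disc, $T$ the unit circle with normalized Lebesgue measure $m$, and let $H^p$ be the Hardy space of analytic functions $f$ on $D$ with $\|f\|_p^p=\sup_{0<r<1}\int_T|f(r\zeta)|^p\,dm(\zeta)<\infty$. Let $\phi(z)=\frac{\lambda(z-a)}{1-\overline a z}$ and $\psi(z)=\frac{\mu(z-c)}{1-\overline c z}$, with $a,c\in D$ and $|\lambda|=|\mu|=1$, be automorphisms of $D$, and suppose that $\phi$ is parabolic, i.e. $\phi$ has exactly one fixed point in $\overline D$ and this point lies on $T$. Write $\phi_n$ for the $n$-fold composition of $\phi$ with itself ($\phi_0(z)=z$), and let $$ S f = M_\psi U_\phi f=\psi\cdot(\overline\lambda\,\phi')^{1/p}\cdot (f\circ\phi) ,$$ where the principal branch of the $p$-th root is used. Then $S$ is a linear isometry of $H^p$ into $H^p$ whose range has codimension one, but $S$ is not Crownover, that is, $\bigcap_{n=1}^\infty S^nH^p\neq(0)$. Moreover, for every $n\ge 0$ the function $\psi\circ\phi_n$ has exactly one zero $b_n$ in $D$, and $(b_n)$ is a Blaschke sequence: $\sum_{n=0}^\infty(1-|b_n|)<\infty$.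 -/

import Mathlib

noncomputable section

namespace HardyIsometry

open Complex ComplexConjugate Metric Set

/-- A holomorphic automorphism `z ↦ lam * (z - a) / (1 - conj a * z)` of the unit disc, recorded by
its (uniquely determined) parameters `a` in the open disc and `lam` on the unit circle. -/
structure DiscAut where
  /-- the unimodular factor -/
  lam : Circle
  /-- the zero of the automorphism -/
  a : UnitDisc

/-- The automorphism as a rational function; its only pole lies outside the closed disc. -/
def DiscAut.toFun (φ : DiscAut) (z : ℂ) : ℂ :=
  (φ.lam : ℂ) * (z - (φ.a : ℂ)) / (1 - conj (φ.a : ℂ) * z)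

theorem DiscAut.norm_toFun_lt_one (φ : DiscAut) {z : ℂ} (hz : ‖z‖ < 1) : ‖φ.toFun z‖ < 1 := by
  have ha : ‖(φ.a : ℂ)‖ < 1 := φ.a.norm_lt_one
  have hne : 1 - conj (φ.a : ℂ) * z ≠ 0 := by
    intro h
    have h1 : ‖conj (φ.a : ℂ) * z‖ = 1 := by
      rw [← sub_eq_zero.mp h, norm_one]
    rw [norm_mul, RCLike.norm_conj] at h1
    nlinarith [norm_nonneg (φ.a : ℂ), norm_nonneg z]
  have hpos : 0 < ‖1 - conj (φ.a : ℂ) * z‖ := norm_pos_iff.mpr hne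
  rw [DiscAut.toFun, norm_div, norm_mul, Circle.norm_coe, one_mul, div_lt_one hpos]
  refine lt_of_pow_lt_pow_left₀ 2 hpos.le ?_
  have key : ‖1 - conj (φ.a : ℂ) * z‖ ^ 2 - ‖z - (φ.a : ℂ)‖ ^ 2
      = (1 - ‖z‖ ^ 2) * (1 - ‖(φ.a : ℂ)‖ ^ 2) := by
    simp only [← Complex.normSq_eq_norm_sq, Complex.normSq_apply]
    simp
    ring
  have h1 : 0 < 1 - ‖z‖ ^ 2 := by nlinarith [norm_nonneg z]
  have h2 : 0 < 1 - ‖(φ.a : ℂ)‖ ^ 2 := by nlinarith [norm_nonneg (φ.a : ℂ)]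
  nlinarith [mul_pos h1 h2]

/-- The automorphism as a self-map of the open unit disc. -/
def DiscAut.onDisc (φ : DiscAut) (z : UnitDisc) : UnitDisc :=
  UnitDisc.mk (φ.toFun z) (φ.norm_toFun_lt_one z.norm_lt_one)

/-- `φ` is parabolic: it has exactly one fixed point in the closed unit disc, and this point lies
on the unit circle. -/
def DiscAut.IsParabolic (φ : DiscAut) : Prop :=
  ∃ w : ℂ, ‖w‖ = 1 ∧ φ.toFun w = w ∧ ∀ z : ℂ, ‖z‖ ≤ 1 → φ.toFun z = z → z = w

/-- Extension by zero of a function on the open unit disc to the plane. -/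
def extend (f : UnitDisc → ℂ) : ℂ → ℂ :=
  Function.extend (fun z : UnitDisc => (z : ℂ)) f 0

/-- The integral mean `∫_T |f(rζ)|^p dm(ζ)`, with `m` the normalized Lebesgue measure. -/
def pMean (p : ℝ) (f : UnitDisc → ℂ) (r : ℝ) : ℝ :=
  Real.circleAverage (fun z => ‖extend f z‖ ^ p) 0 r

theorem extend_apply (f : UnitDisc → ℂ) (z : UnitDisc) : extend f z = f z :=
  UnitDisc.coe_injective.extend_apply f 0 z

theorem extend_add (f g : UnitDisc → ℂ) : extend (f + g) = extend f + extend g := by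
  simpa [extend] using Function.extend_add (fun z : UnitDisc => (z : ℂ)) f g 0 0

theorem extend_smul (c : ℂ) (f : UnitDisc → ℂ) : extend (c • f) = c • extend f := by
  simpa [extend] using Function.extend_smul c (fun z : UnitDisc => (z : ℂ)) f 0

theorem extend_zero : extend 0 = 0 := by
  simpa using extend_smul 0 0

theorem circleIntegrable_norm_rpow {p : ℝ} (hp : 1 ≤ p) {F : ℂ → ℂ}
    (hF : ContinuousOn F (ball 0 1)) {r : ℝ} (hr : r ∈ Ioo (0 : ℝ) 1) :
    CircleIntegrable (fun z => ‖F z‖ ^ p) 0 r := by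
  refine ContinuousOn.circleIntegrable hr.1.le ?_
  refine ContinuousOn.rpow_const (hF.mono ?_).norm (fun _ _ => Or.inr (by linarith))
  exact sphere_subset_closedBall.trans (closedBall_subset_ball hr.2)

theorem pMean_add_le {p : ℝ} (hp : 1 ≤ p) {f g : UnitDisc → ℂ}
    (hf : ContinuousOn (extend f) (ball 0 1)) (hg : ContinuousOn (extend g) (ball 0 1))
    {r : ℝ} (hr : r ∈ Ioo (0 : ℝ) 1) :
    pMean p (f + g) r ≤ 2 ^ (p - 1) * (pMean p f r + pMean p g r) := by
  have hif := circleIntegrable_norm_rpow hp hf hr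
  have hig := circleIntegrable_norm_rpow hp hg hr
  have h2 : (2 : ℝ) ^ (p - 1) * (pMean p f r + pMean p g r) = Real.circleAverage
      ((2 : ℝ) ^ (p - 1) • ((fun z => ‖extend f z‖ ^ p) + fun z => ‖extend g z‖ ^ p)) 0 r := by
    rw [Real.circleAverage_smul, Real.circleAverage_add hif hig]
    rfl
  rw [h2]
  refine Real.circleAverage_mono ?_ ((hif.add hig).const_smul) ?_
  · rw [extend_add]
    exact circleIntegrable_norm_rpow hp (hf.add hg) hr
  · intro z _
    simp only [extend_add, Pi.add_apply, Pi.smul_apply, smul_eq_mul]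
    exact (Real.rpow_le_rpow (norm_nonneg _) (norm_add_le _ _) (by linarith)).trans
      (by exact_mod_cast NNReal.rpow_add_le_mul_rpow_add_rpow ‖extend f z‖₊ ‖extend g z‖₊ hp)

/-- The Hardy space `H^p` of the unit disc: the analytic functions on the disc whose `p`-means over
the circles of radius `r < 1` are bounded. -/
def hardySpace (p : ℝ) (hp : 1 ≤ p) : Submodule ℂ (UnitDisc → ℂ) where
  carrier := {f | DifferentiableOn ℂ (extend f) (ball 0 1) ∧
    BddAbove (pMean p f '' Ioo (0 : ℝ) 1)}
  add_mem' := by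
    rintro f g ⟨hf, A, hA⟩ ⟨hg, B, hB⟩
    refine ⟨by rw [extend_add]; exact hf.add hg, 2 ^ (p - 1) * (A + B), ?_⟩
    rintro _ ⟨r, hr, rfl⟩
    refine (pMean_add_le hp hf.continuousOn hg.continuousOn hr).trans ?_
    have h1 := hA ⟨r, hr, rfl⟩
    have h2 := hB ⟨r, hr, rfl⟩
    gcongr
  zero_mem' := by
    refine ⟨by rw [extend_zero]; exact differentiableOn_const 0, 0, ?_⟩
    rintro _ ⟨r, _, rfl⟩
    simp [pMean, extend_zero, Real.zero_rpow (by linarith : p ≠ 0), Real.circleAverage_const]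
  smul_mem' := by
    rintro c f ⟨hf, A, hA⟩
    refine ⟨by rw [extend_smul]; exact hf.const_smul c, ‖c‖ ^ p * A, ?_⟩
    rintro _ ⟨r, hr, rfl⟩
    have h : pMean p (c • f) r = ‖c‖ ^ p * pMean p f r := by
      unfold pMean
      rw [← smul_eq_mul, ← Real.circleAverage_smul]
      congr 1
      ext z
      simp [extend_smul, Real.mul_rpow (norm_nonneg c) (norm_nonneg _)]
    rw [h]
    have h1 := hA ⟨r, hr, rfl⟩
    gcongr

/-- The norm of `H^p`. -/
def hardyNorm (p : ℝ) (f : UnitDisc → ℂ) : ℝ :=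
  sSup (pMean p f '' Ioo (0 : ℝ) 1) ^ (1 / p)

/-- The operator `M_F` of multiplication by `F`. -/
def mulOp (F : UnitDisc → ℂ) : Module.End ℂ (UnitDisc → ℂ) :=
  LinearMap.mulLeft ℂ F

/-- The operator `C_φ` of composition with `φ`. -/
def compOp (φ : DiscAut) : Module.End ℂ (UnitDisc → ℂ) :=
  LinearMap.funLeft ℂ ℂ φ.onDisc

/-- The operator `U_φ f = (conj lam * φ')^(1/p) * (f ∘ φ)`, with the principal branch. -/
def weightedCompOp (p : ℝ) (φ : DiscAut) : Module.End ℂ (UnitDisc → ℂ) :=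
  mulOp (fun z => (conj (φ.lam : ℂ) * deriv φ.toFun z) ^ ((1 / p : ℝ) : ℂ)) * compOp φ

/-- The linear operator `S` restricts to an isometry of `H^p` into itself whose range has
codimension one in `H^p`. -/
structure IsCodimOneIsometry (p : ℝ) (hp : 1 ≤ p) (S : Module.End ℂ (UnitDisc → ℂ)) : Prop where
  mapsTo : ∀ f ∈ hardySpace p hp, S f ∈ hardySpace p hp
  norm_map : ∀ f ∈ hardySpace p hp, hardyNorm p (S f) = hardyNorm p f
  codim : Module.finrank ℂ
    (hardySpace p hp ⧸ ((hardySpace p hp).map S).submoduleOf (hardySpace p hp)) = 1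

/-- `S` is Crownover: a codimension one isometry of `H^p` with `⋂_{n ≥ 1} S^n H^p = (0)`. -/
def IsCrownover (p : ℝ) (hp : 1 ≤ p) (S : Module.End ℂ (UnitDisc → ℂ)) : Prop :=
  IsCodimOneIsometry p hp S ∧
    (⨅ n : ℕ, (hardySpace p hp).map (S ^ (n + 1))) = ⊥

end HardyIsometry

end

/-! No boundary values are used: the `H^p` norm is the supremum of the means over circles of radius
`r < 1`, and each factor of `S` is shown to leave the set of upper bounds of these means unchanged.

For `U_φ`, subharmonicity of `‖f‖ ^ p` bounds a mean inside the disc by one on the unit circle.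
There `|weight| ^ p = |φ'|` is the Jacobian of `φ`, so a change of variables removes `φ`; dilations
`f(ρ ·)` with `ρ → 1` make the boundary integral legitimate. The opposite bound is the same one for
`φ.inv`, because `U_φ` and `U_{φ⁻¹}` are exact inverses. For `M_ψ`, `|ψ| ≤ 1` and `|ψ| → 1`
uniformly at the circle. Since `U_φ` is onto, the range of `S` is `ψ H^p`, the kernel of evaluation
at the zero `c` of `ψ`; hence codimension one.

Put `b_n = φ_n⁻¹(c)`. Peeling off one factor of `S` at a time shows that `S^n H^p` contains every `f
∈ H^p` vanishing at `b_0, …, b_{n-1}`. A Cayley transform turns the parabolic `φ` into a real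
translation `ζ ↦ ζ + t`, so `b_n` becomes `ζ_c - n t`. This gives `1 - |b_n| = O(n⁻²)`. It also
gives, without a Blaschke product, a nonzero bounded function with all the required zeros, namely `1
- exp(2πi(ζ - ζ_c)/|t|)`, which lies in every `S^n H^p`. -/

namespace HardyIsometry

open Complex ComplexConjugate Metric Set Real MeasureTheory Filter Topology

/-! ### Poisson kernel and monotonicity of integral means. -/

section Subharmonicity

variable {p R : ℝ} {c w : ℂ}

theorem continuousOn_poissonKernel_sphere (hw : w ∈ ball c R) :
    ContinuousOn (poissonKernel c w) (sphere c R) := by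
  have hR : |R| = R := abs_of_pos (pos_of_mem_ball hw)
  rw [poissonKernel_eq_re_herglotzRieszKernel]
  have := continuousOn_herglotzRieszKernel_sphere hw
  rw [hR] at this
  exact Complex.continuous_re.comp_continuousOn this

theorem poissonKernel_nonneg_of_mem_sphere {z : ℂ} (hw : w ∈ ball c R) (hz : z ∈ sphere c R) :
    0 ≤ poissonKernel c w z := by
  rw [poissonKernel_def]
  rw [mem_ball_iff_norm] at hw
  rw [mem_sphere_iff_norm] at hz
  refine div_nonneg ?_ (by positivity)
  rw [hz]
  nlinarith [norm_nonneg (w - c)]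

theorem circleAverage_poissonKernel (hw : w ∈ ball c R) :
    circleAverage (poissonKernel c w) c R = 1 := by
  have h := InnerProductSpace.HarmonicOnNhd.circleAverage_poissonKernel_smul (f := fun _ => (1 : ℝ))
    (c := c) (R := R) (fun z _ => InnerProductSpace.harmonicAt_const (1 : ℝ)) hw
  rw [← h]
  congr 1
  ext z
  simp

/-- Convexity: the graph of `x ^ p` lies above its tangent at `v`. This is Bernoulli's inequality
rescaled by `v`, and it serves as a hand-made Jensen inequality below. -/
theorem rpow_add_mul_sub_le_rpow (hp : 1 ≤ p) {v x : ℝ} (hv : 0 < v) (hx : 0 ≤ x) :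
    v ^ p + p * v ^ (p - 1) * (x - v) ≤ x ^ p := by
  have h := one_add_mul_self_le_rpow_one_add (s := x / v - 1)
    (by have := div_nonneg hx hv.le; linarith) hp
  have h1 : (1 + (x / v - 1)) ^ p = x ^ p / v ^ p := by
    rw [← div_rpow hx hv.le]; congr 1; ring
  have hvp : 0 < v ^ p := rpow_pos_of_pos hv p
  rw [h1, le_div_iff₀ hvp] at h
  have h2 : v ^ (p - 1) = v ^ p / v := by rw [rpow_sub hv, rpow_one]
  rw [h2]
  calc _ = (1 + p * (x / v - 1)) * v ^ p := by field_simp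
    _ ≤ _ := h

/-- Subharmonicity of `‖f‖ ^ p` for an analytic function `f`. -/
theorem norm_rpow_le_circleAverage_poissonKernel (hp : 1 ≤ p) {f : ℂ → ℂ}
    (hf : DiffContOnCl ℂ f (ball c R)) (hw : w ∈ ball c R) :
    ‖f w‖ ^ p ≤ circleAverage (fun z => poissonKernel c w z * ‖f z‖ ^ p) c R := by
  have hR : 0 < R := pos_of_mem_ball hw
  have hP := continuousOn_poissonKernel_sphere hw
  have hfc : ContinuousOn f (sphere c R) :=
    hf.continuousOn_ball.mono sphere_subset_closedBall
  have hnp : ContinuousOn (fun z => ‖f z‖ ^ p) (sphere c R) :=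
    hfc.norm.rpow_const fun _ _ => Or.inr (by linarith)
  have hnn : ∀ z ∈ sphere c |R|, 0 ≤ poissonKernel c w z := fun z hz =>
    poissonKernel_nonneg_of_mem_sphere hw (by rwa [abs_of_pos hR] at hz)
  have hI : CircleIntegrable (fun z => poissonKernel c w z * ‖f z‖ ^ p) c R :=
    (hP.mul hnp).circleIntegrable hR.le
  have hN : CircleIntegrable (fun z => poissonKernel c w z * ‖f z‖) c R :=
    (hP.mul hfc.norm).circleIntegrable hR.le
  have hPI : CircleIntegrable (poissonKernel c w) c R := hP.circleIntegrable hR.le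
  rcases (norm_nonneg (f w)).eq_or_lt with h0 | hv
  · rw [← h0, zero_rpow (by linarith)]
    exact circleAverage_nonneg_of_nonneg fun z hz => mul_nonneg (hnn z hz) (by positivity)
  have hle : ‖f w‖ ≤ circleAverage (fun z => poissonKernel c w z * ‖f z‖) c R := by
    rw [← hf.circleAverage_poissonKernel_smul hw, circleAverage_def, circleAverage_def, norm_smul,
      Real.norm_of_nonneg (by positivity), smul_eq_mul]
    gcongr
    refine (intervalIntegral.norm_integral_le_integral_norm (by positivity)).trans_eq ?_
    congr 1
    ext θ
    rw [Pi.smul_apply', norm_smul, Real.norm_of_nonneg (hnn _ (circleMap_mem_sphere' c R θ))]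
  set v := ‖f w‖ with hvdef
  -- The tangent-line inequality at `v = ‖f w‖` is integrated against the Poisson kernel, a
  -- probability density. By `hle` the linear term contributes a nonnegative amount, leaving `v ^
  -- p`.
  have hkey : circleAverage (fun z => (v ^ p - p * v ^ (p - 1) * v) • poissonKernel c w z +
      (p * v ^ (p - 1)) • (poissonKernel c w z * ‖f z‖)) c R ≤
      circleAverage (fun z => poissonKernel c w z * ‖f z‖ ^ p) c R := by
    refine circleAverage_mono (hPI.const_fun_smul.add hN.const_fun_smul) hI fun z hz => ?_
    have := mul_le_mul_of_nonneg_left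
      (rpow_add_mul_sub_le_rpow hp hv (norm_nonneg (f z))) (hnn z hz)
    simp only [smul_eq_mul]
    linarith
  refine le_trans ?_ hkey
  rw [circleAverage_fun_add hPI.const_fun_smul hN.const_fun_smul, circleAverage_fun_smul,
    circleAverage_fun_smul, circleAverage_poissonKernel hw]
  have hc : 0 ≤ p * v ^ (p - 1) := by positivity
  have := mul_le_mul_of_nonneg_left hle hc
  simp only [smul_eq_mul]
  linarith

/-- The integral means of an analytic function increase with the radius. -/
theorem circleAverage_norm_rpow_le (hp : 1 ≤ p) {f : ℂ → ℂ} (hf : DiffContOnCl ℂ f (ball 0 R))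
    {s : ℝ} (hs : 0 ≤ s) (hsR : s < R) :
    circleAverage (fun z => ‖f z‖ ^ p) 0 s ≤ circleAverage (fun z => ‖f z‖ ^ p) 0 R := by
  have hR : 0 < R := hs.trans_lt hsR
  have hw : (s : ℂ) ∈ ball (0 : ℂ) R := by simpa [abs_of_nonneg hs] using hsR
  have hcl : ContinuousOn (fun z => ‖f z‖ ^ p) (closedBall 0 R) :=
    hf.continuousOn_ball.norm.rpow_const fun _ _ => Or.inr (by linarith)
  have hcirc : ∀ r, 0 ≤ r → r ≤ R → ∀ θ, circleMap 0 r θ ∈ closedBall (0 : ℂ) R :=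
    fun r h0 hr θ => by simpa [abs_of_nonneg h0] using hr
  have hPc : Continuous fun η => poissonKernel 0 (s : ℂ) (circleMap 0 R η) :=
    (continuousOn_poissonKernel_sphere hw).comp_continuous (continuous_circleMap 0 R)
      fun η => circleMap_mem_sphere 0 hR.le η
  have hK : Continuous fun x : ℝ × ℝ =>
      poissonKernel 0 (s : ℂ) (circleMap 0 R x.2) * ‖f (circleMap 0 R (x.1 + x.2))‖ ^ p :=
    (hPc.comp continuous_snd).mul <| hcl.comp_continuous
      ((continuous_circleMap 0 R).comp (continuous_fst.add continuous_snd))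
      fun x => hcirc R hR.le le_rfl _
  -- Rotating `f` moves `s e^{iθ}` to the fixed point `s`, so one kernel serves all `θ`. After
  -- Fubini the inner `θ`-integral no longer depends on `η`.
  have hpt : ∀ θ, ‖f (circleMap 0 s θ)‖ ^ p ≤ (2 * π)⁻¹ * ∫ η in 0..2 * π,
      poissonKernel 0 (s : ℂ) (circleMap 0 R η) * ‖f (circleMap 0 R (θ + η))‖ ^ p := by
    intro θ
    have hrot : DiffContOnCl ℂ (fun z => f (cexp (θ * I) * z)) (ball 0 R) := by
      refine hf.comp (Differentiable.diffContOnCl (by fun_prop)) fun z hz => ?_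
      simpa [norm_exp_ofReal_mul_I] using hz
    have h := norm_rpow_le_circleAverage_poissonKernel hp hrot hw
    have hs' : cexp (θ * I) * s = circleMap 0 s θ := by simp [circleMap, mul_comm]
    have hη : ∀ η, cexp (θ * I) * circleMap 0 R η = circleMap 0 R (θ + η) := fun η => by
      simp [circleMap, add_mul, Complex.exp_add]; ring
    simpa only [circleAverage_def, hs', hη, smul_eq_mul] using h
  have hint : ∀ η, (2 * π)⁻¹ * ∫ θ in 0..2 * π, ‖f (circleMap 0 R (θ + η))‖ ^ p =
      circleAverage (fun z => ‖f z‖ ^ p) 0 R := fun η => by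
    rw [circleAverage_eq_integral_add η, smul_eq_mul]
  calc circleAverage (fun z => ‖f z‖ ^ p) 0 s
      ≤ (2 * π)⁻¹ * ∫ θ in 0..2 * π, (2 * π)⁻¹ * ∫ η in 0..2 * π,
        poissonKernel 0 (s : ℂ) (circleMap 0 R η) * ‖f (circleMap 0 R (θ + η))‖ ^ p := by
        rw [circleAverage_def, smul_eq_mul]
        gcongr
        refine intervalIntegral.integral_mono_on (by positivity)
          (Continuous.intervalIntegrable ?_ _ _) (Continuous.intervalIntegrable ?_ _ _)
          fun θ _ => hpt θ
        · exact hcl.comp_continuous (continuous_circleMap 0 s) (hcirc s hs hsR.le)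
        · exact continuous_const.mul
            (intervalIntegral.continuous_parametric_intervalIntegral_of_continuous' hK _ _)
    _ = (2 * π)⁻¹ * ∫ η in 0..2 * π, poissonKernel 0 (s : ℂ) (circleMap 0 R η) *
        ((2 * π)⁻¹ * ∫ θ in 0..2 * π, ‖f (circleMap 0 R (θ + η))‖ ^ p) := by
        rw [intervalIntegral.integral_const_mul, intervalIntegral_intervalIntegral_swap]
        · rw [← intervalIntegral.integral_const_mul]
          simp only [intervalIntegral.integral_const_mul, mul_left_comm]
        · exact (hK.continuousOn.integrableOn_compact (isCompact_uIcc.prod isCompact_uIcc)).mono_set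
            (prod_mono uIoc_subset_uIcc uIoc_subset_uIcc)
    _ = circleAverage (fun z => ‖f z‖ ^ p) 0 R := by
        simp only [hint]
        have h1 := circleAverage_poissonKernel hw
        rw [circleAverage_def, smul_eq_mul] at h1
        rw [intervalIntegral.integral_mul_const, ← mul_assoc, h1, one_mul]

end Subharmonicity

/-! ### Disc automorphisms: weight, inverse, action on the circle. -/

namespace DiscAut

variable (φ : DiscAut) {z : ℂ}

theorem re_one_sub_pos (hz : ‖z‖ ≤ 1) : 0 < (1 - conj (φ.a : ℂ) * z).re := by
  have h : (conj (φ.a : ℂ) * z).re < 1 := by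
    refine (Complex.re_le_norm _).trans_lt ?_
    rw [norm_mul, RCLike.norm_conj]
    nlinarith [φ.a.norm_lt_one, norm_nonneg (φ.a : ℂ), norm_nonneg z]
  rw [sub_re, one_re]
  linarith

theorem one_sub_ne_zero (hz : ‖z‖ ≤ 1) : 1 - conj (φ.a : ℂ) * z ≠ 0 := fun h => by
  have := φ.re_one_sub_pos hz
  simp [h] at this

theorem one_sub_sq_pos : 0 < 1 - ‖(φ.a : ℂ)‖ ^ 2 := sub_pos.mpr φ.a.sq_norm_lt_one

theorem conj_mul_lam : conj (φ.lam : ℂ) * φ.lam = 1 := by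
  rw [← normSq_eq_conj_mul_self, Circle.normSq_coe, ofReal_one]

theorem one_sub_norm_sq_toFun (hz : ‖z‖ ≤ 1) :
    1 - ‖φ.toFun z‖ ^ 2 =
      (1 - ‖(φ.a : ℂ)‖ ^ 2) * (1 - ‖z‖ ^ 2) / ‖1 - conj (φ.a : ℂ) * z‖ ^ 2 := by
  have hne : ‖1 - conj (φ.a : ℂ) * z‖ ^ 2 ≠ 0 :=
    pow_ne_zero _ (norm_ne_zero_iff.mpr (φ.one_sub_ne_zero hz))
  have key : ‖1 - conj (φ.a : ℂ) * z‖ ^ 2 - ‖z - (φ.a : ℂ)‖ ^ 2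
      = (1 - ‖z‖ ^ 2) * (1 - ‖(φ.a : ℂ)‖ ^ 2) := by
    simp only [← Complex.normSq_eq_norm_sq, Complex.normSq_apply]
    simp
    ring
  rw [toFun, norm_div, norm_mul, Circle.norm_coe, one_mul, div_pow, eq_div_iff hne, sub_mul,
    one_mul, div_mul_cancel₀ _ hne, key]
  ring

theorem norm_toFun_le_one (hz : ‖z‖ ≤ 1) : ‖φ.toFun z‖ ≤ 1 := by
  have h := φ.one_sub_norm_sq_toFun hz
  have : 0 ≤ 1 - ‖φ.toFun z‖ ^ 2 := by
    rw [h]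
    have := φ.one_sub_sq_pos
    have h1 : 0 ≤ 1 - ‖z‖ ^ 2 := by nlinarith [norm_nonneg z]
    positivity
  nlinarith [norm_nonneg (φ.toFun z)]

theorem hasDerivAt_toFun (hz : ‖z‖ ≤ 1) : HasDerivAt φ.toFun
    (φ.lam * ((1 - ‖(φ.a : ℂ)‖ ^ 2 : ℝ) / (1 - conj (φ.a : ℂ) * z) ^ 2)) z := by
  have hne := φ.one_sub_ne_zero hz
  have h := (((hasDerivAt_id z).sub_const (φ.a : ℂ)).const_mul (φ.lam : ℂ)).div
    (((hasDerivAt_id z).const_mul (conj (φ.a : ℂ))).const_sub 1) hne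
  refine HasDerivAt.congr_deriv (f := φ.toFun) h ?_
  have hne' : 1 - z * conj (φ.a : ℂ) ≠ 0 := by rwa [mul_comm z]
  simp only [id]
  push_cast
  rw [← conj_mul']
  field_simp
  ring

theorem differentiableOn_toFun : DifferentiableOn ℂ φ.toFun (closedBall 0 1) := fun z hz =>
  (φ.hasDerivAt_toFun (by simpa using hz)).differentiableAt.differentiableWithinAt

theorem conj_lam_mul_deriv (hz : ‖z‖ ≤ 1) : conj (φ.lam : ℂ) * deriv φ.toFun z =
    (1 - ‖(φ.a : ℂ)‖ ^ 2 : ℝ) / (1 - conj (φ.a : ℂ) * z) ^ 2 := by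
  rw [(φ.hasDerivAt_toFun hz).deriv, ← mul_assoc, φ.conj_mul_lam, one_mul]

/-- The value is a positive multiple of `u ^ 2` with `u = 1 / (1 - conj a * z)` and `Re u > 0`;
squaring the right half-plane avoids the negative axis. Hence the principal root is analytic. -/
theorem conj_lam_mul_deriv_mem_slitPlane (hz : ‖z‖ ≤ 1) :
    conj (φ.lam : ℂ) * deriv φ.toFun z ∈ slitPlane := by
  rw [φ.conj_lam_mul_deriv hz]
  have h0 := φ.one_sub_sq_pos
  have h1 : 0 < ((1 - conj (φ.a : ℂ) * z)⁻¹).re := by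
    rw [inv_re]
    exact div_pos (φ.re_one_sub_pos hz) (normSq_pos.mpr (φ.one_sub_ne_zero hz))
  rw [div_eq_mul_inv, ← inv_pow]
  generalize (1 - conj (φ.a : ℂ) * z)⁻¹ = u at h1
  rw [mem_slitPlane_iff, re_ofReal_mul, im_ofReal_mul, pow_two u, mul_re, mul_im]
  by_cases hu : u.im = 0
  · left; rw [hu]; simp; positivity
  · right
    have : u.re * u.im ≠ 0 := mul_ne_zero h1.ne' hu
    refine mul_ne_zero h0.ne' ?_
    contrapose! this
    linarith

/-- The weight `(conj lam * φ')^(1/p)` on the plane. -/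
noncomputable def weight (p : ℝ) (z : ℂ) : ℂ :=
  (conj (φ.lam : ℂ) * deriv φ.toFun z) ^ ((1 / p : ℝ) : ℂ)

theorem differentiableOn_weight (p : ℝ) : DifferentiableOn ℂ (φ.weight p) (closedBall 0 1) := by
  have hz : ∀ z ∈ closedBall (0 : ℂ) 1, ‖z‖ ≤ 1 := fun z hz => by simpa using hz
  have h : DifferentiableOn ℂ (fun z : ℂ => conj (φ.lam : ℂ) * deriv φ.toFun z)
      (closedBall 0 1) := by
    refine DifferentiableOn.congr (f := fun z => ((1 - ‖(φ.a : ℂ)‖ ^ 2 : ℝ) : ℂ) /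
      (1 - conj (φ.a : ℂ) * z) ^ 2) ?_ fun z h => φ.conj_lam_mul_deriv (hz z h)
    exact DifferentiableOn.div (by fun_prop) (by fun_prop)
      fun z h => pow_ne_zero _ (φ.one_sub_ne_zero (hz z h))
  exact h.cpow_const fun z h => φ.conj_lam_mul_deriv_mem_slitPlane (hz z h)

theorem weight_ne_zero (p : ℝ) (hz : ‖z‖ ≤ 1) : φ.weight p z ≠ 0 := by
  rw [weight, Ne, cpow_eq_zero_iff]
  exact fun h => slitPlane_ne_zero (φ.conj_lam_mul_deriv_mem_slitPlane hz) h.1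

theorem norm_weight_rpow {p : ℝ} (hp : 1 ≤ p) : ‖φ.weight p z‖ ^ p = ‖deriv φ.toFun z‖ := by
  rw [weight, norm_cpow_real, ← rpow_mul (norm_nonneg _), one_div,
    inv_mul_cancel₀ (by linarith), rpow_one, norm_mul, RCLike.norm_conj, Circle.norm_coe, one_mul]

/-- The inverse automorphism. -/
noncomputable def inv : DiscAut where
  lam := φ.lam⁻¹
  a := -(φ.lam • φ.a)

theorem toFun_inv_toFun (hz : ‖z‖ ≤ 1) : φ.inv.toFun (φ.toFun z) = z := by
  have hne : 1 - z * conj (φ.a : ℂ) ≠ 0 := by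
    rw [mul_comm z]
    exact φ.one_sub_ne_zero hz
  have hne' := φ.one_sub_ne_zero hz
  have hl := φ.conj_mul_lam
  have hl0 : (φ.lam : ℂ) ≠ 0 := Circle.coe_ne_zero _
  have h1 : 1 - conj (φ.inv.a : ℂ) * φ.toFun z =
      ((1 - ‖(φ.a : ℂ)‖ ^ 2 : ℝ) : ℂ) / (1 - conj (φ.a : ℂ) * z) := by
    simp only [inv, toFun, UnitDisc.coe_neg, UnitDisc.coe_circle_smul, map_neg, map_mul]
    push_cast
    rw [← conj_mul']
    field_simp
    linear_combination (conj (φ.a : ℂ)) * (z - φ.a) * hl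
  have h2 : φ.toFun z - (φ.inv.a : ℂ) =
      φ.lam * (((1 - ‖(φ.a : ℂ)‖ ^ 2 : ℝ) : ℂ) * z) / (1 - conj (φ.a : ℂ) * z) := by
    simp only [inv, toFun, UnitDisc.coe_neg, UnitDisc.coe_circle_smul]
    push_cast
    rw [← conj_mul']
    field_simp
    ring
  have h3 : ((1 - ‖(φ.a : ℂ)‖ ^ 2 : ℝ) : ℂ) ≠ 0 := ofReal_ne_zero.mpr φ.one_sub_sq_pos.ne'
  rw [toFun, h1, h2]
  simp only [inv, Circle.coe_inv]
  field_simp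

theorem inv_inv : φ.inv.inv = φ := by
  cases φ with
  | mk l a =>
    simp only [inv, _root_.inv_inv, mk.injEq, true_and]
    rw [← UnitDisc.coe_inj]
    simp

theorem inv_onDisc_onDisc (z : UnitDisc) : φ.inv.onDisc (φ.onDisc z) = z := by
  rw [← UnitDisc.coe_inj]
  exact φ.toFun_inv_toFun z.norm_lt_one.le

theorem onDisc_inv_onDisc (z : UnitDisc) : φ.onDisc (φ.inv.onDisc z) = z := by
  have := φ.inv.inv_onDisc_onDisc z
  rwa [inv_inv] at this

/-- By the chain rule the two bases are reciprocal, and off the negative axis the principal power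
respects inverses. So no unimodular constant appears when `U_φ` is inverted. -/
theorem weight_mul_weight_inv (p : ℝ) (hz : ‖z‖ ≤ 1) :
    φ.weight p z * φ.inv.weight p (φ.toFun z) = 1 := by
  have h : HasDerivAt (φ.inv.toFun ∘ φ.toFun)
      (deriv φ.inv.toFun (φ.toFun z) * deriv φ.toFun z) z :=
    (φ.inv.hasDerivAt_toFun (φ.norm_toFun_le_one hz)).differentiableAt.hasDerivAt.comp z
      (φ.hasDerivAt_toFun hz).differentiableAt.hasDerivAt
  -- The identity `φ⁻¹ ∘ φ = id` is available only on the closed disc, so at boundary points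
  -- derivatives are compared within that set.
  have hU : UniqueDiffWithinAt ℂ (closedBall (0 : ℂ) 1) z := by
    refine uniqueDiffWithinAt_convex_of_isRCLikeNormedField (𝕜 := ℂ) (convex_closedBall 0 1) ?_ ?_
    · exact ⟨0, ball_subset_interior_closedBall (by simp)⟩
    · exact subset_closure (by simpa using hz)
  have h2 : HasDerivWithinAt (φ.inv.toFun ∘ φ.toFun) 1 (closedBall (0 : ℂ) 1) z :=
    (hasDerivWithinAt_id z _).congr (fun y hy => φ.toFun_inv_toFun (by simpa using hy))
      (φ.toFun_inv_toFun hz)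
  have h3 := hU.eq_deriv _ h.hasDerivWithinAt h2
  have hs := φ.conj_lam_mul_deriv_mem_slitPlane hz
  have h4 : conj (φ.inv.lam : ℂ) * deriv φ.inv.toFun (φ.toFun z) =
      (conj (φ.lam : ℂ) * deriv φ.toFun z)⁻¹ := by
    apply eq_inv_of_mul_eq_one_left
    have : conj (φ.inv.lam : ℂ) * conj (φ.lam : ℂ) = 1 := by
      rw [← map_mul, ← Circle.coe_mul]
      simp [inv]
    linear_combination (deriv φ.inv.toFun (φ.toFun z) * deriv φ.toFun z) * this + h3
  rw [weight, weight, h4, inv_cpow _ _ (slitPlane_arg_ne_pi hs), mul_inv_cancel₀]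
  exact φ.weight_ne_zero p hz

/-- Infinitesimally, this says that the argument of `φ(e^{iθ})` increases at rate `|φ'(e^{iθ})|`. -/
theorem mul_deriv_toFun_of_norm_eq_one (hz : ‖z‖ = 1) :
    z * deriv φ.toFun z = ‖deriv φ.toFun z‖ * φ.toFun z := by
  have hne : 1 - z * conj (φ.a : ℂ) ≠ 0 := by
    rw [mul_comm z]
    exact φ.one_sub_ne_zero hz.le
  have hne' : 1 - (φ.a : ℂ) * conj z ≠ 0 := by
    have := (map_ne_zero (starRingEnd ℂ)).mpr hne
    rw [mul_comm]
    simpa using this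
  have hzz : z * conj z = 1 := by rw [mul_conj', hz]; simp
  rw [(φ.hasDerivAt_toFun hz.le).deriv, norm_mul, Circle.norm_coe, one_mul, norm_div, norm_pow,
    norm_real, Real.norm_of_nonneg φ.one_sub_sq_pos.le, ofReal_div, ofReal_pow, ← mul_conj', toFun]
  simp only [map_sub, map_one, map_mul, conj_conj]
  field_simp
  linear_combination (-(φ.a : ℂ)) * ((1 - ‖(φ.a : ℂ)‖ ^ 2 : ℝ) : ℂ) * hzz

theorem norm_deriv_toFun_of_norm_eq_one (hz : ‖z‖ = 1) :
    ‖deriv φ.toFun z‖ = poissonKernel 0 φ.a z := by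
  have h := φ.mul_deriv_toFun_of_norm_eq_one hz
  have hn : ‖1 - conj (φ.a : ℂ) * z‖ = ‖z - φ.a‖ := by
    have hzz : z * conj z = 1 := by rw [mul_conj', hz]; simp
    rw [← RCLike.norm_conj, ← one_mul ‖conj _‖, ← hz, ← norm_mul]
    congr 1
    simp only [map_sub, map_one, map_mul, conj_conj]
    linear_combination (-(φ.a : ℂ)) * hzz
  rw [(φ.hasDerivAt_toFun hz.le).deriv, norm_mul, Circle.norm_coe, one_mul, norm_div, norm_pow,
    norm_real, Real.norm_of_nonneg φ.one_sub_sq_pos.le, poissonKernel_def, hn]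
  simp [hz]

/-- The normalized Lebesgue measure on the circle changes under `φ` by the factor `|φ'|`. -/
theorem circleAverage_norm_deriv_mul_comp {h : ℂ → ℝ} (hh : ContinuousOn h (sphere 0 1)) :
    circleAverage (fun z => ‖deriv φ.toFun z‖ * h (φ.toFun z)) 0 1 = circleAverage h 0 1 := by
  have hnorm : ∀ θ, ‖circleMap 0 1 θ‖ = 1 := fun θ => by simp
  have ha : (φ.a : ℂ) ∈ ball (0 : ℂ) 1 := by simpa using φ.a.norm_lt_one
  set K : ℝ → ℝ := fun θ => ‖deriv φ.toFun (circleMap 0 1 θ)‖ with hKdef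
  have hKP : K = fun θ => poissonKernel 0 φ.a (circleMap 0 1 θ) :=
    funext fun θ => φ.norm_deriv_toFun_of_norm_eq_one (hnorm θ)
  have hK : Continuous K := by
    rw [hKP]
    exact (continuousOn_poissonKernel_sphere ha).comp_continuous (continuous_circleMap 0 1)
      fun θ => circleMap_mem_sphere 0 zero_le_one θ
  set α : ℝ := arg (φ.toFun 1)
  -- `g` is a continuous argument of `φ(e^{iθ})`: `hlift` holds because `φ(e^{iθ}) e^{-i g(θ)}` has
  -- derivative zero and equals `1` at `θ = 0`.
  set g : ℝ → ℝ := fun θ => α + ∫ t in 0..θ, K t with hg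
  have hg' : ∀ θ, HasDerivAt g (K θ) θ := fun θ =>
    (intervalIntegral.integral_hasDerivAt_right (hK.intervalIntegrable _ _)
      hK.stronglyMeasurable.stronglyMeasurableAtFilter hK.continuousAt).const_add α
  have hone : ∀ z : ℂ, ‖z‖ = 1 → ‖φ.toFun z‖ = 1 := fun z hz => by
    have := φ.one_sub_norm_sq_toFun hz.le
    rw [hz] at this
    simp only [one_pow, sub_self, mul_zero, zero_div] at this
    nlinarith [norm_nonneg (φ.toFun z)]
  have hlift : ∀ θ, φ.toFun (circleMap 0 1 θ) = circleMap 0 1 (g θ) := by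
    have hE : ∀ θ, HasDerivAt (fun θ => φ.toFun (circleMap 0 1 θ) * cexp (-(g θ : ℂ) * I)) 0 θ := by
      intro θ
      have h1 : HasDerivAt (fun θ => φ.toFun (circleMap 0 1 θ))
          (deriv φ.toFun (circleMap 0 1 θ) * (circleMap 0 1 θ * I)) θ :=
        (φ.hasDerivAt_toFun (hnorm θ).le).differentiableAt.hasDerivAt.comp θ
          (hasDerivAt_circleMap 0 1 θ)
      have h2 := ((((hg' θ).ofReal_comp).neg).mul_const I).cexp
      refine (h1.mul h2).congr_deriv ?_
      have := φ.mul_deriv_toFun_of_norm_eq_one (hnorm θ)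
      linear_combination (I * cexp (-(g θ : ℂ) * I)) * this
    have hconst := is_const_of_deriv_eq_zero (fun θ => (hE θ).differentiableAt)
      (fun θ => (hE θ).deriv)
    intro θ
    have h0 := hconst θ 0
    have hφ1 : φ.toFun 1 = cexp (α * I) := by
      have := norm_mul_exp_arg_mul_I (φ.toFun 1)
      rw [hone 1 (by simp)] at this
      simpa using this.symm
    have hg0 : g 0 = α := by simp [hg]
    have hc0 : circleMap 0 1 0 = 1 := by simp [circleMap]
    simp only [hg0, hc0, hφ1] at h0
    rw [← Complex.exp_add, neg_mul, neg_mul, add_neg_cancel, Complex.exp_zero, Complex.exp_neg,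
      mul_inv_eq_one₀ (Complex.exp_ne_zero _)] at h0
    rw [h0]
    simp [circleMap]
  have hH : Continuous fun u => h (circleMap 0 1 u) :=
    hh.comp_continuous (continuous_circleMap 0 1) fun θ => circleMap_mem_sphere 0 zero_le_one θ
  have hper : Function.Periodic (fun u => h (circleMap 0 1 u)) (2 * π) := fun u => by
    simp [periodic_circleMap 0 1 u]
  -- On the circle `|φ'|` is a Poisson kernel, of mean one, so `φ` winds exactly once.
  have hg2 : g (2 * π) = g 0 + 2 * π := by
    have h1 := circleAverage_poissonKernel ha
    rw [circleAverage_def, smul_eq_mul, inv_mul_eq_one₀ (by positivity)] at h1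
    simp only [hg, intervalIntegral.integral_same, add_zero, hKP, ← h1]
  calc circleAverage (fun z => ‖deriv φ.toFun z‖ * h (φ.toFun z)) 0 1
      = (2 * π)⁻¹ * ∫ θ in 0..2 * π, ((fun u => h (circleMap 0 1 u)) ∘ g) θ * K θ := by
        simp only [circleAverage_def, smul_eq_mul, hlift, Function.comp_apply, hKdef, mul_comm]
    _ = (2 * π)⁻¹ * ∫ u in g 0..g (2 * π), h (circleMap 0 1 u) := by
        rw [intervalIntegral.integral_comp_mul_deriv (fun θ _ => hg' θ) hK.continuousOn hH]
    _ = circleAverage h 0 1 := by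
        rw [hg2, hper.intervalIntegral_add_eq (g 0) 0, zero_add, circleAverage_def, smul_eq_mul]

end DiscAut

/-! ### Integral means and membership in `H^p`. -/

section Means

variable {p : ℝ} {f g : UnitDisc → ℂ}

theorem extend_eqOn {G : ℂ → ℂ} (h : ∀ z : UnitDisc, f z = G z) :
    EqOn (extend f) G (ball 0 1) := fun z hz => by
  have hz' : ‖z‖ < 1 := by simpa using hz
  have := extend_apply f (UnitDisc.mk z hz')
  rwa [h, UnitDisc.coe_mk] at this

theorem sphere_subset_unit_ball {r : ℝ} (hr : r ∈ Ioo (0 : ℝ) 1) :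
    sphere (0 : ℂ) |r| ⊆ ball 0 1 := by
  rw [abs_of_pos hr.1]
  exact sphere_subset_closedBall.trans (closedBall_subset_ball hr.2)

theorem pMean_eq_circleAverage {G : ℂ → ℂ} (h : ∀ z : UnitDisc, f z = G z) {r : ℝ}
    (hr : r ∈ Ioo (0 : ℝ) 1) : pMean p f r = circleAverage (fun z => ‖G z‖ ^ p) 0 r :=
  circleAverage_congr_sphere fun z hz => by
    simp only [extend_eqOn h (sphere_subset_unit_ball hr hz)]

theorem pMean_mono (hp : 1 ≤ p) (hf : DifferentiableOn ℂ (extend f) (ball 0 1)) {s r : ℝ}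
    (hs : 0 < s) (hsr : s ≤ r) (hr : r < 1) : pMean p f s ≤ pMean p f r := by
  rcases hsr.eq_or_lt with rfl | hlt
  · rfl
  · refine circleAverage_norm_rpow_le hp (DifferentiableOn.diffContOnCl ?_) hs.le hlt
    exact hf.mono (closure_ball_subset_closedBall.trans (closedBall_subset_ball hr))

/-- Working with sets of upper bounds settles membership in `H^p` and equality of norms together. -/
theorem hardyNorm_eq_of_upperBounds_eq
    (h : upperBounds (pMean p f '' Ioo (0 : ℝ) 1) = upperBounds (pMean p g '' Ioo (0 : ℝ) 1))
    (hf : BddAbove (pMean p f '' Ioo (0 : ℝ) 1)) : hardyNorm p f = hardyNorm p g := by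
  have hne : ∀ k : UnitDisc → ℂ, (pMean p k '' Ioo (0 : ℝ) 1).Nonempty := fun k =>
    (nonempty_Ioo.mpr one_pos).image _
  have hg : BddAbove (pMean p g '' Ioo (0 : ℝ) 1) := by rwa [BddAbove, ← h]
  have h1 := isLUB_csSup (hne f) hf
  have h2 := isLUB_csSup (hne g) hg
  rw [IsLUB, h] at h1
  rw [hardyNorm, hardyNorm, h1.unique h2]

theorem mem_upperBounds_pMean {B : ℝ} : B ∈ upperBounds (pMean p f '' Ioo (0 : ℝ) 1) ↔
    ∀ r ∈ Ioo (0 : ℝ) 1, pMean p f r ≤ B := by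
  simp only [upperBounds, forall_mem_image, mem_ofPred_eq]

/-- Bounded analytic functions belong to every Hardy space. -/
theorem mem_hardySpace_of_bounded (hp : 1 ≤ p) (hf : DifferentiableOn ℂ (extend f) (ball 0 1))
    {C : ℝ} (hC : ∀ z, ‖f z‖ ≤ C) : f ∈ hardySpace p hp := by
  refine ⟨hf, C ^ p, mem_upperBounds_pMean.mpr fun r hr => ?_⟩
  refine circleAverage_mono_on_of_le_circle
    (circleIntegrable_norm_rpow hp hf.continuousOn hr) fun z hz => ?_
  have hz' : ‖z‖ < 1 := by simpa using sphere_subset_unit_ball hr hz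
  rw [← UnitDisc.coe_mk z hz', extend_apply]
  exact rpow_le_rpow (norm_nonneg _) (hC _) (by linarith)

end Means

/-! ### The operators `U_φ` and `M_ψ` on `H^p`. -/

section Operators

variable {p : ℝ} (φ ψ : DiscAut) {f : UnitDisc → ℂ}

theorem weightedCompOp_apply (z : UnitDisc) :
    weightedCompOp p φ f z = φ.weight p z * f (φ.onDisc z) := rfl

theorem weightedCompOp_inv_apply (f : UnitDisc → ℂ) :
    weightedCompOp p φ (weightedCompOp p φ.inv f) = f := by
  ext z
  rw [weightedCompOp_apply, weightedCompOp_apply, DiscAut.inv_onDisc_onDisc, ← mul_assoc]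
  have := φ.weight_mul_weight_inv p z.norm_lt_one.le
  rw [DiscAut.onDisc, UnitDisc.coe_mk, this, one_mul]

theorem inv_weightedCompOp_apply (f : UnitDisc → ℂ) :
    weightedCompOp p φ.inv (weightedCompOp p φ f) = f := by
  have := weightedCompOp_inv_apply (p := p) φ.inv f
  rwa [DiscAut.inv_inv] at this

theorem weightedCompOp_eq (z : UnitDisc) :
    weightedCompOp p φ f z = φ.weight p z * extend f (φ.toFun z) := by
  rw [weightedCompOp_apply, ← extend_apply f, DiscAut.onDisc, UnitDisc.coe_mk]

theorem differentiableOn_weightedCompOp (hf : DifferentiableOn ℂ (extend f) (ball 0 1)) :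
    DifferentiableOn ℂ (extend (weightedCompOp p φ f)) (ball 0 1) := by
  refine DifferentiableOn.congr ?_ (extend_eqOn
    (G := fun z => φ.weight p z * extend f (φ.toFun z)) (weightedCompOp_eq φ))
  refine ((φ.differentiableOn_weight p).mono ball_subset_closedBall).mul
    (hf.comp (φ.differentiableOn_toFun.mono ball_subset_closedBall) fun z hz => ?_)
  simpa using φ.norm_toFun_lt_one (by simpa using hz)

/-- The weighted composition operator does not increase the bounds of the integral means. -/
theorem pMean_weightedCompOp_le (hp : 1 ≤ p) (hf : DifferentiableOn ℂ (extend f) (ball 0 1))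
    {B : ℝ} (hB : ∀ r ∈ Ioo (0 : ℝ) 1, pMean p f r ≤ B) {s : ℝ} (hs : s ∈ Ioo (0 : ℝ) 1) :
    pMean p (weightedCompOp p φ f) s ≤ B := by
  -- For `ρ < 1` the dilate `f(ρ ·)` is regular up to the unit circle, where the change of variables
  -- applies; the wanted mean `k 1` is the limit as `ρ → 1`.
  set k : ℝ → ℝ := fun ρ =>
    circleAverage (fun z => ‖φ.weight p z * extend f (ρ * φ.toFun z)‖ ^ p) 0 s with hk
  have hk1 : pMean p (weightedCompOp p φ f) s = k 1 := by
    rw [pMean_eq_circleAverage (G := fun z => φ.weight p z * extend f (φ.toFun z))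
      (weightedCompOp_eq φ) hs]
    simp [hk]
  have hle : ∀ ρ ∈ Ioo (0 : ℝ) 1, k ρ ≤ B := by
    intro ρ hρ
    have hmaps : MapsTo (fun z : ℂ => (ρ : ℂ) * z) (closedBall 0 1) (ball 0 1) := fun z hz => by
      have hz' : ‖z‖ ≤ 1 := by simpa using hz
      have : ‖(ρ : ℂ) * z‖ < 1 := by
        rw [norm_mul, norm_real, Real.norm_of_nonneg hρ.1.le]
        nlinarith [hρ.1, hρ.2, norm_nonneg z]
      simpa using this
    have hρf : DifferentiableOn ℂ (fun z => extend f (ρ * z)) (closedBall 0 1) :=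
      hf.comp (by fun_prop) hmaps
    have hG : DiffContOnCl ℂ (fun z => φ.weight p z * extend f (ρ * φ.toFun z)) (ball 0 1) := by
      refine DifferentiableOn.diffContOnCl ?_
      rw [closure_ball _ one_ne_zero]
      refine (φ.differentiableOn_weight p).mul
        (hρf.comp φ.differentiableOn_toFun fun z hz => ?_)
      simpa using φ.norm_toFun_le_one (by simpa using hz)
    calc k ρ ≤ circleAverage (fun z => ‖φ.weight p z * extend f (ρ * φ.toFun z)‖ ^ p) 0 1 :=
          circleAverage_norm_rpow_le hp hG hs.1.le hs.2
      _ = circleAverage (fun z => ‖deriv φ.toFun z‖ *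
            (fun w : ℂ => ‖extend f (ρ * w)‖ ^ p) (φ.toFun z)) 0 1 := by
          congr 1
          ext z
          rw [norm_mul, mul_rpow (norm_nonneg _) (norm_nonneg _), φ.norm_weight_rpow hp]
      _ = circleAverage (fun w : ℂ => ‖extend f (ρ * w)‖ ^ p) 0 1 :=
          φ.circleAverage_norm_deriv_mul_comp <|
            (hρf.continuousOn.mono sphere_subset_closedBall).norm.rpow_const
              fun _ _ => Or.inr (by linarith)
      _ = pMean p f ρ := by
          simp [pMean, circleAverage_def, circleMap]
      _ ≤ B := hB ρ hρ
  have hcont : ContinuousOn k (Icc 0 1) := by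
    rw [continuousOn_iff_continuous_domRestrict]
    suffices h : Continuous fun x : Icc (0 : ℝ) 1 × ℝ =>
        ‖φ.weight p (circleMap 0 s x.2) *
          extend f ((x.1 : ℝ) * φ.toFun (circleMap 0 s x.2))‖ ^ p from
      (intervalIntegral.continuous_parametric_intervalIntegral_of_continuous'
        (μ := volume) (f := fun (ρ : Icc (0 : ℝ) 1) θ => ‖φ.weight p (circleMap 0 s θ) *
          extend f ((ρ : ℝ) * φ.toFun (circleMap 0 s θ))‖ ^ p) h 0 (2 * π)).const_smul (2 * π)⁻¹
    have hc : ∀ θ, circleMap 0 s θ ∈ closedBall (0 : ℂ) 1 := fun θ => by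
      simpa [abs_of_pos hs.1] using hs.2.le
    have h1 : Continuous fun x : Icc (0 : ℝ) 1 × ℝ => φ.weight p (circleMap 0 s x.2) :=
      (φ.differentiableOn_weight p).continuousOn.comp_continuous (by fun_prop) fun x => hc x.2
    have h2 : Continuous fun x : Icc (0 : ℝ) 1 × ℝ => φ.toFun (circleMap 0 s x.2) :=
      φ.differentiableOn_toFun.continuousOn.comp_continuous (by fun_prop) fun x => hc x.2
    have h3 : Continuous fun x : Icc (0 : ℝ) 1 × ℝ =>
        extend f ((x.1 : ℝ) * φ.toFun (circleMap 0 s x.2)) := by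
      refine hf.continuousOn.comp_continuous (by fun_prop) fun x => ?_
      have hlt : ‖φ.toFun (circleMap 0 s x.2)‖ < 1 :=
        φ.norm_toFun_lt_one (by simpa [abs_of_pos hs.1] using hs.2)
      have : ‖((x.1 : ℝ) : ℂ) * φ.toFun (circleMap 0 s x.2)‖ < 1 := by
        rw [norm_mul, norm_real, Real.norm_of_nonneg x.1.2.1]
        nlinarith [x.1.2.1, x.1.2.2, norm_nonneg (φ.toFun (circleMap 0 s x.2))]
      simpa using this
    exact (h1.mul h3).norm.rpow_const fun _ => Or.inr (by linarith)
  have hne : (𝓝[Ioo (0 : ℝ) 1] 1).NeBot := by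
    rw [← mem_closure_iff_nhdsWithin_neBot, closure_Ioo zero_ne_one]
    exact right_mem_Icc.mpr zero_le_one
  rw [hk1]
  exact le_of_tendsto ((hcont 1 (right_mem_Icc.mpr zero_le_one)).mono Ioo_subset_Icc_self)
    (eventually_mem_nhdsWithin.mono hle)

theorem upperBounds_weightedCompOp (hp : 1 ≤ p)
    (hf : DifferentiableOn ℂ (extend f) (ball 0 1)) :
    upperBounds (pMean p (weightedCompOp p φ f) '' Ioo (0 : ℝ) 1) =
      upperBounds (pMean p f '' Ioo (0 : ℝ) 1) := by
  ext B
  rw [mem_upperBounds_pMean, mem_upperBounds_pMean]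
  refine ⟨fun h s hs => ?_, fun h s hs => pMean_weightedCompOp_le φ hp hf h hs⟩
  have := pMean_weightedCompOp_le φ.inv hp (differentiableOn_weightedCompOp φ hf) h hs
  rwa [inv_weightedCompOp_apply] at this

theorem weightedCompOp_mem (hp : 1 ≤ p) (hf : f ∈ hardySpace p hp) :
    weightedCompOp p φ f ∈ hardySpace p hp := by
  refine ⟨differentiableOn_weightedCompOp φ hf.1, ?_⟩
  rw [BddAbove, upperBounds_weightedCompOp φ hp hf.1]
  exact hf.2

/-- Multiplication by a disc automorphism. -/
noncomputable abbrev mulAut : Module.End ℂ (UnitDisc → ℂ) :=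
  mulOp fun z => (ψ.onDisc z : ℂ)

theorem mulAut_eq (z : UnitDisc) : mulAut ψ f z = ψ.toFun z * extend f z := by
  rw [extend_apply]
  rfl

theorem differentiableOn_mulAut (hf : DifferentiableOn ℂ (extend f) (ball 0 1)) :
    DifferentiableOn ℂ (extend (mulAut ψ f)) (ball 0 1) :=
  ((ψ.differentiableOn_toFun.mono ball_subset_closedBall).mul hf).congr
    (extend_eqOn (mulAut_eq ψ))

/-- The bound depends on `‖z‖` only and tends to `1` at the circle. Far from the circle the radicand
may be negative, and then `√` is `0`. -/
theorem DiscAut.sqrt_le_norm_toFun {z : ℂ} (hz : ‖z‖ ≤ 1) :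
    √(1 - (1 - ‖(ψ.a : ℂ)‖ ^ 2) * (1 - ‖z‖ ^ 2) / (1 - ‖(ψ.a : ℂ)‖) ^ 2) ≤ ‖ψ.toFun z‖ := by
  refine Real.sqrt_le_iff.mpr ⟨norm_nonneg _, ?_⟩
  have h := ψ.one_sub_norm_sq_toFun hz
  have ha := ψ.a.norm_lt_one
  have h0 := ψ.one_sub_sq_pos
  have h1 : 0 ≤ 1 - ‖z‖ ^ 2 := by nlinarith [norm_nonneg z]
  have h2 : 1 - ‖(ψ.a : ℂ)‖ ≤ ‖1 - conj (ψ.a : ℂ) * z‖ := by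
    have := norm_sub_norm_le (1 : ℂ) (conj (ψ.a : ℂ) * z)
    rw [norm_one, norm_mul, RCLike.norm_conj] at this
    nlinarith [norm_nonneg (ψ.a : ℂ)]
  have h3 : (1 - ‖(ψ.a : ℂ)‖ ^ 2) * (1 - ‖z‖ ^ 2) / ‖1 - conj (ψ.a : ℂ) * z‖ ^ 2 ≤
      (1 - ‖(ψ.a : ℂ)‖ ^ 2) * (1 - ‖z‖ ^ 2) / (1 - ‖(ψ.a : ℂ)‖) ^ 2 := by
    have : 0 < 1 - ‖(ψ.a : ℂ)‖ := by linarith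
    gcongr
  linarith

/-- For `r < t < 1`, the mean of `f` at `r` is at most that at `t`, which the lower bound for `|ψ|`
compares with the mean of `ψ f`; then `t → 1`. The other direction is `|ψ| ≤ 1`. -/
theorem upperBounds_mulAut (hp : 1 ≤ p) (hf : DifferentiableOn ℂ (extend f) (ball 0 1)) :
    upperBounds (pMean p (mulAut ψ f) '' Ioo (0 : ℝ) 1) =
      upperBounds (pMean p f '' Ioo (0 : ℝ) 1) := by
  have hψf : ContinuousOn (fun z => ψ.toFun z * extend f z) (ball 0 1) :=
    (ψ.differentiableOn_toFun.continuousOn.mono ball_subset_closedBall).mul hf.continuousOn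
  ext B
  rw [mem_upperBounds_pMean, mem_upperBounds_pMean]
  constructor
  · intro h r hr
    set l : ℝ → ℝ := fun t =>
      √(1 - (1 - ‖(ψ.a : ℂ)‖ ^ 2) * (1 - t ^ 2) / (1 - ‖(ψ.a : ℂ)‖) ^ 2) ^ p * pMean p f r with hl
    have hle : ∀ t ∈ Ioo r 1, l t ≤ B := by
      intro t ht
      have ht' : t ∈ Ioo (0 : ℝ) 1 := ⟨hr.1.trans ht.1, ht.2⟩
      refine le_trans ?_ (h t ht')
      refine (mul_le_mul_of_nonneg_left (pMean_mono hp hf hr.1 ht.1.le ht.2)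
        (by positivity)).trans ?_
      rw [pMean_eq_circleAverage (G := fun z => ψ.toFun z * extend f z) (mulAut_eq ψ) ht', pMean,
        ← smul_eq_mul, ← circleAverage_smul]
      refine circleAverage_mono
        (circleIntegrable_norm_rpow hp hf.continuousOn ht').const_smul
        (circleIntegrable_norm_rpow hp hψf ht') fun z hz => ?_
      have hz' : ‖z‖ = t := by simpa [abs_of_pos ht'.1] using hz
      have := ψ.sqrt_le_norm_toFun (z := z) (by rw [hz']; exact ht.2.le)
      rw [hz'] at this
      simp only [Pi.smul_apply, smul_eq_mul]
      rw [norm_mul, mul_rpow (norm_nonneg _) (norm_nonneg _)]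
      gcongr
    have hcont : Continuous l := by
      refine Continuous.mul (Continuous.rpow_const ?_ fun _ => Or.inr (by linarith))
        continuous_const
      fun_prop
    have h1 : l 1 = pMean p f r := by simp [hl]
    have hne : (𝓝[Ioo r 1] 1).NeBot := by
      rw [← mem_closure_iff_nhdsWithin_neBot, closure_Ioo hr.2.ne]
      exact right_mem_Icc.mpr hr.2.le
    rw [← h1]
    exact le_of_tendsto (hcont.continuousWithinAt (s := Ioo r 1))
      (eventually_mem_nhdsWithin.mono hle)
  · intro h r hr
    refine le_trans ?_ (h r hr)
    rw [pMean_eq_circleAverage (G := fun z => ψ.toFun z * extend f z) (mulAut_eq ψ) hr]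
    refine circleAverage_mono (circleIntegrable_norm_rpow hp hψf hr)
      (circleIntegrable_norm_rpow hp hf.continuousOn hr) fun z hz => ?_
    have hz' : ‖z‖ = r := by simpa [abs_of_pos hr.1] using hz
    have h1 := ψ.norm_toFun_le_one (z := z) (by rw [hz']; exact hr.2.le)
    simp only [norm_mul]
    refine rpow_le_rpow (by positivity) ?_ (by linarith)
    exact mul_le_of_le_one_left (norm_nonneg _) h1

theorem mulAut_mem_iff (hp : 1 ≤ p) (hf : DifferentiableOn ℂ (extend f) (ball 0 1)) :
    mulAut ψ f ∈ hardySpace p hp ↔ f ∈ hardySpace p hp := by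
  have h := upperBounds_mulAut ψ hp hf
  refine ⟨fun ⟨_, h2⟩ => ⟨hf, ?_⟩, fun ⟨_, h2⟩ => ⟨differentiableOn_mulAut ψ hf, ?_⟩⟩
  · rwa [BddAbove, ← h]
  · rwa [BddAbove, h]

/-- A function of `H^p` that vanishes at the zero of `ψ` is divisible by `ψ` in `H^p`. -/
theorem exists_mulAut_eq (hp : 1 ≤ p) (hf : f ∈ hardySpace p hp) (h0 : f ψ.a = 0) :
    ∃ g ∈ hardySpace p hp, mulAut ψ g = f := by
  have ha : ball (0 : ℂ) 1 ∈ 𝓝 (ψ.a : ℂ) :=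
    isOpen_ball.mem_nhds (by simpa using ψ.a.norm_lt_one)
  set d := dslope (extend f) ψ.a with hd
  -- This is `f / ψ`: `dslope` divides by `z - a` and removes the singularity, and the other factors
  -- are those of `1 / ψ`.
  set G : ℂ → ℂ := fun z => conj (ψ.lam : ℂ) * (1 - conj (ψ.a : ℂ) * z) * d z with hG
  have hGd : DifferentiableOn ℂ G (ball 0 1) := by
    have : DifferentiableOn ℂ d (ball 0 1) := (differentiableOn_dslope ha).mpr hf.1
    fun_prop
  set g : UnitDisc → ℂ := fun z => G z
  have hg : DifferentiableOn ℂ (extend g) (ball 0 1) := hGd.congr (extend_eqOn fun _ => rfl)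
  have hψg : mulAut ψ g = f := by
    ext z
    have hne := ψ.one_sub_ne_zero z.norm_lt_one.le
    have h1 : ((z : ℂ) - ψ.a) * d z = f z := by
      have := sub_smul_dslope (extend f) (ψ.a : ℂ) (z : ℂ)
      rwa [extend_apply, extend_apply, h0, sub_zero, smul_eq_mul] at this
    rw [mulAut_eq, extend_apply, ← h1]
    simp only [g, hG, DiscAut.toFun]
    have hl := ψ.conj_mul_lam
    rw [div_mul_eq_mul_div, div_eq_iff hne]
    linear_combination ((z : ℂ) - ψ.a) * (1 - conj (ψ.a : ℂ) * z) * d z * hl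
  refine ⟨g, ?_, hψg⟩
  rw [← mulAut_mem_iff ψ hp hg, hψg]
  exact hf

/-- The range of `M_ψ U_φ` on `H^p` consists of the functions vanishing at the zero of `ψ`. -/
theorem mem_map_mulAut_mul_weightedCompOp (hp : 1 ≤ p) :
    f ∈ (hardySpace p hp).map (mulAut ψ * weightedCompOp p φ) ↔
      f ∈ hardySpace p hp ∧ f ψ.a = 0 := by
  constructor
  · rintro ⟨g, hg, rfl⟩
    have hU := weightedCompOp_mem φ hp hg
    refine ⟨(mulAut_mem_iff ψ hp hU.1).mpr hU, ?_⟩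
    rw [Module.End.mul_apply, mulAut_eq, DiscAut.toFun, sub_self]
    simp
  · rintro ⟨hf, h0⟩
    obtain ⟨g, hg, rfl⟩ := exists_mulAut_eq ψ hp hf h0
    exact ⟨weightedCompOp p φ.inv g, weightedCompOp_mem φ.inv hp hg, by
      rw [Module.End.mul_apply, weightedCompOp_inv_apply]⟩

theorem isCodimOneIsometry_mulAut_mul_weightedCompOp (hp : 1 ≤ p) :
    IsCodimOneIsometry p hp (mulAut ψ * weightedCompOp p φ) where
  mapsTo f hf := ((mem_map_mulAut_mul_weightedCompOp φ ψ hp).mp ⟨f, hf, rfl⟩).1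
  norm_map f hf := by
    have hU := weightedCompOp_mem φ hp hf
    have h := (upperBounds_mulAut ψ hp hU.1).trans (upperBounds_weightedCompOp φ hp hf.1)
    refine (hardyNorm_eq_of_upperBounds_eq h.symm hf.2).symm
  codim := by
    -- Evaluation at the zero of `ψ` is onto `ℂ` because constants lie in `H^p`.
    let ev : hardySpace p hp →ₗ[ℂ] ℂ := LinearMap.proj ψ.a ∘ₗ (hardySpace p hp).subtype
    have hev : Function.Surjective ev := fun w => by
      refine ⟨⟨fun _ => w, mem_hardySpace_of_bounded hp ?_ (fun _ => le_rfl)⟩, rfl⟩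
      exact (differentiableOn_const w).congr (extend_eqOn fun _ => rfl)
    have hker : ((hardySpace p hp).map (mulAut ψ * weightedCompOp p φ)).submoduleOf
        (hardySpace p hp) = ev.ker := by
      ext f
      rw [LinearMap.mem_ker]
      exact (mem_map_mulAut_mul_weightedCompOp φ ψ hp).trans (and_iff_right f.2)
    rw [hker, (ev.quotKerEquivOfSurjective hev).finrank_eq, Module.finrank_self]

end Operators

/-! ### Half-plane model, backward orbit and failure of the Crownover property. -/

section Parabolic

/-- The Cayley transform onto the upper half-plane sending the boundary point `w` to infinity. -/
noncomputable def cayley (w z : ℂ) : ℂ := I * (w + z) / (w - z)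

variable {w z : ℂ}

theorem sub_ne_zero_of_norm_lt (hw : ‖w‖ = 1) (hz : ‖z‖ < 1) : w - z ≠ 0 :=
  sub_ne_zero.mpr fun h => by rw [← h, hw] at hz; exact lt_irrefl _ hz

/-- `cayley w z` is `I` times the Herglotz–Riesz kernel, whose real part is the Poisson kernel. -/
theorem cayley_im (hw : ‖w‖ = 1) : (cayley w z).im = (1 - ‖z‖ ^ 2) / ‖w - z‖ ^ 2 := by
  have h := congrFun (poissonKernel_eq_re_herglotzRieszKernel (c := 0) (w := z)) w
  simp only [poissonKernel_def, Function.comp_apply, herglotzRieszKernel_def, sub_zero, hw,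
    one_pow] at h
  rw [h, cayley, mul_div_assoc, I_mul_im]

theorem cayley_im_pos (hw : ‖w‖ = 1) (hz : ‖z‖ < 1) : 0 < (cayley w z).im := by
  rw [cayley_im hw]
  have h1 : 0 < ‖w - z‖ := norm_pos_iff.mpr (sub_ne_zero_of_norm_lt hw hz)
  have h2 : 0 < 1 - ‖z‖ ^ 2 := by nlinarith [norm_nonneg z]
  positivity

theorem one_sub_norm_sq_eq_cayley (hw : ‖w‖ = 1) (hz : ‖z‖ < 1) :
    1 - ‖z‖ ^ 2 = 4 * (cayley w z).im / ‖cayley w z + I‖ ^ 2 := by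
  have hne := sub_ne_zero_of_norm_lt hw hz
  have hne' : ‖w - z‖ ≠ 0 := norm_ne_zero_iff.mpr hne
  have h : cayley w z + I = I * (2 * w) / (w - z) := by
    rw [cayley]; field_simp; ring
  rw [cayley_im hw, h, norm_div, norm_mul, norm_mul, hw, norm_I, Complex.norm_ofNat]
  field_simp
  norm_num

/-- In the half-plane model a parabolic automorphism is a translation. -/
theorem DiscAut.IsParabolic.exists_translation {φ : DiscAut} (hφ : φ.IsParabolic) :
    ∃ (w : ℂ) (t : ℝ), ‖w‖ = 1 ∧ t ≠ 0 ∧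
      ∀ z : ℂ, ‖z‖ < 1 → cayley w (φ.toFun z) = cayley w z + t := by
  obtain ⟨w, hw, hfix, huniq⟩ := hφ
  have hw0 : w ≠ 0 := norm_ne_zero_iff.mp (by rw [hw]; exact one_ne_zero)
  have ha : (φ.a : ℂ) ≠ 0 := fun ha => by
    have h0 := huniq 0 (by simp) (by simp [toFun, ha])
    exact hw0 h0.symm
  have hca : conj (φ.a : ℂ) ≠ 0 := (map_ne_zero _).mpr ha
  have hq : φ.lam * (w - φ.a) = w * (1 - conj (φ.a : ℂ) * w) := by
    rwa [toFun, div_eq_iff (φ.one_sub_ne_zero hw.le)] at hfix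
  -- The fixed-point equation is quadratic, with product of roots `-λ a / conj a`. By Vieta `w'` is
  -- the second root; it is unimodular, so uniqueness makes `w` a double root.
  set w' : ℂ := -(φ.lam * φ.a) / (conj (φ.a : ℂ) * w) with hw'
  have hw'n : ‖w'‖ = 1 := by
    rw [hw', norm_div, norm_neg, norm_mul, norm_mul, RCLike.norm_conj, hw, Circle.norm_coe, one_mul,
      mul_one, div_self (norm_ne_zero_iff.mpr ha)]
  have hprod : conj (φ.a : ℂ) * w * w' = -(φ.lam * φ.a) := by
    rw [hw']; field_simp
  have hsum : conj (φ.a : ℂ) * (w + w') = 1 - φ.lam := by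
    apply mul_left_cancel₀ hw0
    linear_combination hprod + hq
  have heq : w' = w := by
    refine huniq w' hw'n.le ?_
    rw [toFun, div_eq_iff (φ.one_sub_ne_zero hw'n.le)]
    linear_combination w' * hsum - hprod
  rw [heq] at hprod hsum
  set u : ℂ := conj (φ.a : ℂ) * w with hu
  have hlam : (φ.lam : ℂ) = 1 - 2 * u := by linear_combination hsum + 2 * hu
  have hu0 : u ≠ 0 := mul_ne_zero hca hw0
  have hun : ‖u‖ < 1 := by
    rw [hu, norm_mul, hw, RCLike.norm_conj, mul_one]
    exact φ.a.norm_lt_one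
  have hx1 : 0 < 1 - u.re := by linarith [Complex.re_le_norm u]
  -- This is `|λ| = 1` for `λ = 1 - 2u`; it makes `2iu / (1 - u)`, the translation length, real.
  have hxy : u.re ^ 2 + u.im ^ 2 = u.re := by
    have := Circle.normSq_coe φ.lam
    rw [hlam, normSq_apply] at this
    simp at this
    linarith
  have ht : I * (2 * u) = ((-2 * u.im / (1 - u.re) : ℝ) : ℂ) * (1 - u) := by
    apply Complex.ext
    · rw [re_ofReal_mul]
      simp
      field_simp
    · rw [im_ofReal_mul]
      simp
      field_simp
      linarith
  refine ⟨w, -2 * u.im / (1 - u.re), hw, ?_, fun z hz => ?_⟩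
  · refine div_ne_zero (mul_ne_zero (by norm_num) fun hy => hu0 ?_) hx1.ne'
    rw [hy] at hxy
    have hx : u.re = 0 := by
      have : u.re * (1 - u.re) = 0 := by linarith
      exact (mul_eq_zero.mp this).resolve_right hx1.ne'
    exact Complex.ext hx hy
  · have h1 := sub_ne_zero_of_norm_lt hw hz
    have h2 := sub_ne_zero_of_norm_lt hw (φ.norm_toFun_lt_one hz)
    have h3 := φ.one_sub_ne_zero hz.le
    have h4 : w - φ.toFun z = (1 - u) * (w - z) / (1 - conj (φ.a : ℂ) * z) := by
      rw [eq_div_iff h3, sub_mul, toFun, div_mul_cancel₀ _ h3]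
      linear_combination z * hu - z * hlam + hprod
    have h5 : w + φ.toFun z =
        ((1 - u) * (w + z) + 2 * u * (w - z)) / (1 - conj (φ.a : ℂ) * z) := by
      rw [eq_div_iff h3, add_mul, toFun, div_mul_cancel₀ _ h3]
      linear_combination z * hu + z * hlam - hprod
    have h6 : (1 : ℂ) - u ≠ 0 := fun h => by
      rw [h, zero_mul, zero_div] at h4
      exact h2 h4
    rw [cayley, cayley, h4, h5, ← mul_div_assoc, div_div_div_cancel_right₀ h3,
      div_eq_iff (mul_ne_zero h6 h1), add_mul, mul_comm (1 - u) (w - z),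
      ← mul_assoc (I * (w + z) / (w - z)),
      div_mul_cancel₀ _ h1]
    linear_combination (w - z) * ht

variable {φ : DiscAut} {t : ℝ}

theorem cayley_iterate_inv (hT : ∀ z : ℂ, ‖z‖ < 1 → cayley w (φ.toFun z) = cayley w z + t)
    (c : UnitDisc) (n : ℕ) :
    cayley w (φ.inv.onDisc^[n] c : UnitDisc) = cayley w c - n * t := by
  induction n with
  | zero => simp
  | succ n ih =>
    have h := hT (φ.inv.onDisc^[n + 1] c : UnitDisc) (UnitDisc.norm_lt_one _)
    have h2 : φ.toFun (φ.inv.onDisc^[n + 1] c : UnitDisc) = (φ.inv.onDisc^[n] c : UnitDisc) := by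
      rw [Function.iterate_succ_apply']
      exact congrArg UnitDisc.coe (φ.onDisc_inv_onDisc (φ.inv.onDisc^[n] c))
    rw [h2, ih] at h
    push_cast
    linear_combination -h

theorem DiscAut.onDisc_iterate_eq_zero_iff (φ ψ : DiscAut) (n : ℕ) (z : UnitDisc) :
    ψ.onDisc (φ.onDisc^[n] z) = 0 ↔ z = φ.inv.onDisc^[n] ψ.a := by
  have h1 : ∀ y : UnitDisc, ψ.onDisc y = 0 ↔ y = ψ.a := fun y => by
    rw [onDisc, UnitDisc.mk_eq_zero, toFun, div_eq_zero_iff,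
      or_iff_left (ψ.one_sub_ne_zero y.norm_lt_one.le), mul_eq_zero,
      or_iff_right (Circle.coe_ne_zero _), sub_eq_zero, UnitDisc.coe_inj]
  have hl : Function.LeftInverse φ.inv.onDisc^[n] φ.onDisc^[n] :=
    Function.LeftInverse.iterate φ.inv_onDisc_onDisc n
  have hr : Function.RightInverse φ.inv.onDisc^[n] φ.onDisc^[n] :=
    Function.LeftInverse.iterate φ.onDisc_inv_onDisc n
  rw [h1]
  exact ⟨fun h => by rw [← h, hl], fun h => by rw [h, hr]⟩

/-- Along the orbit the height `y` is constant and the real part is `x - n t`, so `1 - |b_n|^2 = 4y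
/ ((x - n t)^2 + (y + 1)^2)`. -/
theorem summable_one_sub_norm_iterate_inv (hw : ‖w‖ = 1) (ht : t ≠ 0)
    (hT : ∀ z : ℂ, ‖z‖ < 1 → cayley w (φ.toFun z) = cayley w z + t) (c : UnitDisc) :
    Summable fun n : ℕ => 1 - ‖(φ.inv.onDisc^[n] c : ℂ)‖ := by
  rw [← summable_nat_add_iff 1]
  set x := (cayley w c).re
  set y := (cayley w c).im with hy
  have hy0 : 0 < y := cayley_im_pos hw c.norm_lt_one
  refine Summable.of_nonneg_of_le (f := fun n : ℕ => 4 * y * (2 * x ^ 2 + 2) / t ^ 2 *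
    (1 / ((n + 1 : ℕ) : ℝ) ^ 2)) (fun n => ?_) (fun n => ?_) ?_
  · linarith [UnitDisc.norm_lt_one (φ.inv.onDisc^[n + 1] c)]
  · set b := φ.inv.onDisc^[n + 1] c with hb
    have hC := cayley_iterate_inv hT c (n + 1)
    rw [← hb] at hC
    have hb1 := b.norm_lt_one
    have h1 : 1 - ‖(b : ℂ)‖ ≤ 1 - ‖(b : ℂ)‖ ^ 2 := by nlinarith [norm_nonneg (b : ℂ)]
    refine h1.trans ?_
    have him : (cayley w b).im = y := by rw [hC, sub_im, ← ofReal_natCast, ← ofReal_mul]; simp [hy]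
    have hsq : ‖cayley w b + I‖ ^ 2 = (x - (n + 1 : ℕ) * t) ^ 2 + (y + 1) ^ 2 := by
      rw [← normSq_eq_norm_sq, normSq_apply, add_re, add_im, him, hC, sub_re, ← ofReal_natCast,
        ← ofReal_mul, ofReal_re, I_re, I_im]
      ring
    rw [one_sub_norm_sq_eq_cayley hw hb1, him, hsq, div_mul_div_comm, mul_one,
      div_le_div_iff₀ (by positivity) (by positivity)]
    -- Write `m t = x - (x - m t)` and use `(α - β)^2 ≤ 2α^2 + 2β^2`; this is the source of the
    -- constant `2x^2 + 2`.
    have key : t ^ 2 * ((n + 1 : ℕ) : ℝ) ^ 2 ≤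
        (2 * x ^ 2 + 2) * ((x - (n + 1 : ℕ) * t) ^ 2 + (y + 1) ^ 2) := by
      generalize ((n + 1 : ℕ) : ℝ) = m
      have hy1 : 1 ≤ (y + 1) ^ 2 := by nlinarith
      calc t ^ 2 * m ^ 2 ≤ 2 * x ^ 2 + 2 * (x - m * t) ^ 2 := by
            nlinarith [sq_nonneg (x + (x - m * t))]
        _ ≤ (2 * x ^ 2 + 2) * ((x - m * t) ^ 2 + 1) := by
            nlinarith [mul_nonneg (sq_nonneg x) (sq_nonneg (x - m * t))]
        _ ≤ _ := by gcongr
    calc 4 * y * (t ^ 2 * ((n + 1 : ℕ) : ℝ) ^ 2)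
        ≤ 4 * y * ((2 * x ^ 2 + 2) * ((x - (n + 1 : ℕ) * t) ^ 2 + (y + 1) ^ 2)) := by gcongr
      _ = _ := by ring
  · exact ((summable_nat_add_iff 1).mpr
      (Real.summable_one_div_nat_pow.mpr one_lt_two)).mul_left _

/-- A bounded analytic function that vanishes along a whole backward orbit of a parabolic
automorphism. -/
theorem exists_bounded_vanishing_on_orbit (hw : ‖w‖ = 1) (ht : t ≠ 0)
    (hT : ∀ z : ℂ, ‖z‖ < 1 → cayley w (φ.toFun z) = cayley w z + t) (c : UnitDisc) :
    ∃ F : UnitDisc → ℂ, F ≠ 0 ∧ DifferentiableOn ℂ (extend F) (ball 0 1) ∧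
      (∃ C, ∀ z, ‖F z‖ ≤ C) ∧ ∀ n : ℕ, F (φ.inv.onDisc^[n] c) = 0 := by
  -- The exponential has period `|t|` in the half-plane coordinate. Using `|t|` instead of `t` keeps
  -- it bounded on the upper half-plane for either sign.
  set G : ℂ → ℂ := fun z => 1 - cexp (2 * π * I * ((cayley w z - cayley w c) / |t|)) with hG
  have hnorm : ∀ z, ‖cexp (2 * π * I * ((cayley w z - cayley w c) / |t|))‖ =
      rexp (2 * π / |t| * ((cayley w c).im - (cayley w z).im)) := fun z => by
    rw [Complex.norm_exp]
    congr 1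
    have : 2 * π * I * ((cayley w z - cayley w c) / |t|) =
        ((2 * π / |t| : ℝ) : ℂ) * (I * (cayley w z - cayley w c)) := by push_cast; ring
    rw [this, re_ofReal_mul, I_mul_re, sub_im]
    ring
  have htpos : 0 < |t| := abs_pos.mpr ht
  refine ⟨fun z => G z, fun h0 => ?_, ?_, ⟨1 + rexp (2 * π / |t| * (cayley w c).im), fun z => ?_⟩,
    fun n => ?_⟩
  -- If `G` vanished identically the exponential would be unimodular and the height constant, but
  -- the height is `1` at `0` and `3` at `w / 2`.
  · have hzero : ∀ z : UnitDisc, (cayley w z).im = (cayley w c).im := fun z => by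
      have h1 : G z = 0 := congrFun h0 z
      have h2 := hnorm z
      rw [← sub_eq_zero.mp h1, norm_one, eq_comm, Real.exp_eq_one_iff] at h2
      have h3 : 2 * π / |t| ≠ 0 := by positivity
      linarith [(mul_eq_zero.mp h2).resolve_left h3]
    have hw0 : w ≠ 0 := norm_ne_zero_iff.mp (by rw [hw]; exact one_ne_zero)
    have h2 : ‖w / 2‖ < 1 := by rw [norm_div, hw]; norm_num
    have e1 := hzero 0
    have e2 := hzero (UnitDisc.mk (w / 2) h2)
    have h3 : ‖w - w / 2‖ = 1 / 2 := by
      rw [show w - w / 2 = w / 2 by ring, norm_div, hw]; norm_num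
    rw [← e1, cayley_im hw, cayley_im hw, UnitDisc.coe_mk, h3, norm_div, hw] at e2
    norm_num [hw] at e2
  · refine DifferentiableOn.congr (f := G) ?_ (extend_eqOn fun _ => rfl)
    have hd : DifferentiableOn ℂ (cayley w) (ball 0 1) := by
      unfold cayley
      exact DifferentiableOn.div (by fun_prop) (by fun_prop)
        fun z hz => sub_ne_zero_of_norm_lt hw (by simpa using hz)
    simp only [hG, div_eq_mul_inv]
    fun_prop
  · refine (norm_sub_le _ _).trans ?_
    rw [norm_one, hnorm]
    have := cayley_im_pos hw z.norm_lt_one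
    gcongr
    linarith
  · simp only [hG, cayley_iterate_inv hT c n]
    rw [sub_eq_zero, eq_comm, Complex.exp_eq_one_iff]
    rcases lt_or_gt_of_ne ht with hneg | hpos
    · refine ⟨n, ?_⟩
      have : (t : ℂ) ≠ 0 := ofReal_ne_zero.mpr ht
      rw [abs_of_neg hneg]
      push_cast
      field_simp
      ring
    · refine ⟨-n, ?_⟩
      have : (t : ℂ) ≠ 0 := ofReal_ne_zero.mpr ht
      rw [abs_of_pos hpos]
      push_cast
      field_simp
      ring

/-- A function of `H^p` vanishing on the first `n` points of the backward orbit of the zero of `ψ`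
lies in the range of the `n`-th power of `M_ψ U_φ`. -/
theorem mem_map_pow_of_vanishing {p : ℝ} (hp : 1 ≤ p) (ψ : DiscAut)
    (hinj : ∀ n : ℕ, φ.inv.onDisc^[n + 1] ψ.a ≠ ψ.a) (n : ℕ) :
    ∀ f ∈ hardySpace p hp, (∀ k < n, f (φ.inv.onDisc^[k] ψ.a) = 0) →
      f ∈ (hardySpace p hp).map ((mulAut ψ * weightedCompOp p φ) ^ n) := by
  induction n with
  | zero => exact fun f hf _ => ⟨f, hf, rfl⟩
  | succ n ih =>
    intro f hf h0
    obtain ⟨g, hg, rfl⟩ := (mem_map_mulAut_mul_weightedCompOp φ ψ hp).mpr ⟨hf, h0 0 n.succ_pos⟩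
    -- With `f = S g`, a zero of `f` at `b_{j+1}` forces one of `g` at `φ(b_{j+1}) = b_j`, since
    -- neither `ψ` nor the weight vanishes at `b_{j+1}`.
    obtain ⟨k, hk, rfl⟩ := ih g hg fun j hj => by
      have h := h0 (j + 1) (Nat.succ_lt_succ hj)
      set b := φ.inv.onDisc^[j + 1] ψ.a with hb
      have hφb : φ.onDisc b = φ.inv.onDisc^[j] ψ.a := by
        rw [hb, Function.iterate_succ_apply', DiscAut.onDisc_inv_onDisc]
      rw [← hφb]
      have hψ : (ψ.onDisc b : ℂ) ≠ 0 := fun h => hinj j <| by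
        rw [UnitDisc.coe_eq_zero] at h
        exact (DiscAut.onDisc_iterate_eq_zero_iff φ ψ 0 b).mp h
      have h' : (ψ.onDisc b : ℂ) * (φ.weight p b * g (φ.onDisc b)) = 0 := h
      exact (mul_eq_zero.mp ((mul_eq_zero.mp h').resolve_left hψ)).resolve_left
        (φ.weight_ne_zero p b.norm_lt_one.le)
    exact ⟨k, hk, by rw [pow_succ']; rfl⟩

end Parabolic

end HardyIsometry

theorem theorem4 (p : ℝ) (hp : 1 ≤ p) (hp2 : p ≠ 2)
    (φ ψ : HardyIsometry.DiscAut) (hφ : φ.IsParabolic) :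
    HardyIsometry.IsCodimOneIsometry p hp
      (HardyIsometry.mulOp (fun z => (ψ.onDisc z : ℂ)) * HardyIsometry.weightedCompOp p φ) ∧
    ¬ HardyIsometry.IsCrownover p hp
      (HardyIsometry.mulOp (fun z => (ψ.onDisc z : ℂ)) * HardyIsometry.weightedCompOp p φ) ∧
    ∃ b : ℕ → Complex.UnitDisc,
      (∀ (n : ℕ) (z : Complex.UnitDisc), ψ.onDisc (φ.onDisc^[n] z) = 0 ↔ z = b n) ∧
      Summable (fun n => 1 - ‖(b n : ℂ)‖) := by
  obtain ⟨w, t, hw, ht, hT⟩ := hφ.exists_translation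
  refine ⟨HardyIsometry.isCodimOneIsometry_mulAut_mul_weightedCompOp φ ψ hp, fun hC => ?_,
    fun n => φ.inv.onDisc^[n] ψ.a, φ.onDisc_iterate_eq_zero_iff ψ,
    HardyIsometry.summable_one_sub_norm_iterate_inv hw ht hT ψ.a⟩
  obtain ⟨F, hF0, hFd, ⟨C, hFC⟩, hFb⟩ :=
    HardyIsometry.exists_bounded_vanishing_on_orbit hw ht hT ψ.a
  -- A return of the orbit to `c` would force `(n + 1) t = 0`.
  have hinj : ∀ n : ℕ, φ.inv.onDisc^[n + 1] ψ.a ≠ ψ.a := fun n h => by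
    have h1 := HardyIsometry.cayley_iterate_inv hT ψ.a (n + 1)
    rw [h, eq_comm, sub_eq_self, mul_eq_zero] at h1
    rcases h1 with h1 | h1
    · exact Nat.cast_ne_zero.mpr n.succ_ne_zero h1
    · exact ht (Complex.ofReal_eq_zero.mp h1)
  refine hF0 ((Submodule.mem_bot ℂ).mp (hC.2 ▸ (Submodule.mem_iInf _).mpr fun n => ?_))
  exact HardyIsometry.mem_map_pow_of_vanishing hp ψ hinj (n + 1) F
    (HardyIsometry.mem_hardySpace_of_bounded hp hFd hFC) fun k _ => hFb k
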